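/- Let $n\ge 2$, $1\le k\le n-1$, $1\le q\le n-1$ be integers, let $a<b$ be real numbers, $I=[a,b]$, and let $\sigma=\{\sigma_1<\dots<\sigma_k\}$ and $\varepsilon=\{\varepsilon_1<\dots<\varepsilon_{n-k}\}$ be subsets of $\{0,\dots,n-1\}$. For $M\in\mathbb R$ let $g_M(t,s)$ denote the Green's function on $I\times I$, when it exists, of the operator $T_n[M]u=u^{(n)}+Mu$ with the boundary conditions $u^{(\sigma_1)}(a)=\dots=u^{(\sigma_k)}(a)=0$, $u^{(\varepsilon_1)}(b)=\dots=u^{(\varepsilon_{n-k})}(b)=0$, and let $v_s^q[M](t)=\frac{\partial^q}{\partial t^q}g_M(t,s)$. Let $c_q$ be the number of elements of $\{\sigma_1-q,\dots,\sigma_k-q\}\cap\{0,\dots,n-q-1\}$ and $d_q$ the number of elements of $\{\varepsilon_1-q,\dots,\varepsilon_{n-k}-q\}\cap\{0,\dots,n-q-1\}$. Let $\alpha^q$ be the least $i\in\{0,\dots,n-1\}$ that is not of the form $\sigma_j-q$ (with $\sigma_j\ge q$) or $\sigma_j-q+n$ (with $\sigma_j<q$), and let $\beta^q$ be defined in the same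 way from $\varepsilon_1,\dots,\varepsilon_{n-k}$. The function $v_s^q[M]$ is called strongly positive (strongly negative) on $I\times I$ if $v_s^q[M](t)>0$ $(<0)$ for a.e. $(t,s)\in(a,b)\times(a,b)$ and, for a.e. $s\in(a,b)$, $(v_s^q[M])^{(\alpha^q)}(a)>0$ $(<0)$ and $(-1)^{\beta^q}(v_s^q[M])^{(\beta^q)}(b)>0$ $(<0)$. Suppose that condition $(N_a)$ holds, that is, $\#\{j:\sigma_j<h\}+\#\{j:\varepsilon_j<h\}\ge h$ for every $h\in\{1,\dots,n-1\}$; that $c_q+d_q=n-q$, $c_q\ge1$ and $d_q\ge1$; and that $\sigma_k=q+c_q-1$ or $\varepsilon_{n-k}=q+d_q-1$. Then: - if $n-q-c_q$ is even, there is no $M\in\mathbb R$ such that $g_M$ exists and $v_s^q[M]$ is strongly negative on $I\times I$; - if $n-q-c_q$ is odd, there is no $M\in\mathbb R$ such that $g_M$ exists and $v_s^q[M]$ is strongly positive on $I\times I$. -/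

import Mathlib

open MeasureTheory Filter Topology

/-- `∂ʲu/∂tʲ (t, s)` for a function `u` of `(t, s)`, where `t` ranges over the interval `[a, b]`
(so the derivatives at `t = a` and `t = b` are one-sided). -/
noncomputable def tDeriv (a b : ℝ) (j : ℕ) (u : ℝ → ℝ → ℝ) (t s : ℝ) : ℝ :=
  iteratedDerivWithin j (fun x => u x s) (Set.Icc a b) t

/-- `g` is the Green's function on `[a, b] × [a, b]` of the operator `T_n[M] u = u⁽ⁿ⁾ + M u`
with the boundary conditions `u⁽ⁱ⁾(a) = 0` for `i ∈ σ` and `u⁽ⁱ⁾(b) = 0` for `i ∈ ε`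
(axiomatic definition, for order `n ≥ 2`). -/
structure IsGreenFunction (n : ℕ) (a b M : ℝ) (σ ε : Finset ℕ) (g : ℝ → ℝ → ℝ) : Prop where
  /-- The `t`-derivatives of order at most `n - 2` exist on the whole square. -/
  contDiffOn_square : ∀ s ∈ Set.Icc a b,
    ContDiffOn ℝ ((n - 2 : ℕ) : ℕ∞) (fun t => g t s) (Set.Icc a b)
  /-- They are continuous on the whole square. -/
  continuousOn_square : ∀ j ≤ n - 2,
    ContinuousOn (fun p : ℝ × ℝ => tDeriv a b j g p.1 p.2) (Set.Icc a b ×ˢ Set.Icc a b)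
  /-- The `t`-derivatives of order at most `n` exist on the triangle `a ≤ s < t ≤ b`. -/
  contDiffOn_lower : ∀ s ∈ Set.Icc a b,
    ContDiffOn ℝ (n : ℕ∞) (fun t => g t s) (Set.Ioc s b)
  /-- They are continuous on that triangle. -/
  continuousOn_lower : ∀ j ≤ n,
    ContinuousOn (fun p : ℝ × ℝ => tDeriv a b j g p.1 p.2)
      {p : ℝ × ℝ | a ≤ p.2 ∧ p.2 < p.1 ∧ p.1 ≤ b}
  /-- The `t`-derivatives of order at most `n` exist on the triangle `a ≤ t < s ≤ b`. -/
  contDiffOn_upper : ∀ s ∈ Set.Icc a b,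
    ContDiffOn ℝ (n : ℕ∞) (fun t => g t s) (Set.Ico a s)
  /-- They are continuous on that triangle. -/
  continuousOn_upper : ∀ j ≤ n,
    ContinuousOn (fun p : ℝ × ℝ => tDeriv a b j g p.1 p.2)
      {p : ℝ × ℝ | a ≤ p.1 ∧ p.1 < p.2 ∧ p.2 ≤ b}
  /-- The `t`-derivative of order `n - 1` has a jump equal to `1` on the diagonal. -/
  jump : ∀ s ∈ Set.Ioo a b, ∃ l : ℝ,
    Tendsto (fun t => tDeriv a b (n - 1) g t s) (𝓝[<] s) (𝓝 l) ∧
    Tendsto (fun t => tDeriv a b (n - 1) g t s) (𝓝[>] s) (𝓝 (l + 1))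
  /-- `T_n[M] g(·, s) = 0` off the diagonal. -/
  equation : ∀ s ∈ Set.Ioo a b, ∀ t ∈ Set.Icc a b, t ≠ s →
    tDeriv a b n g t s + M * g t s = 0
  /-- The boundary conditions at `t = a`. -/
  boundary_left : ∀ s ∈ Set.Ioo a b, ∀ i ∈ σ, tDeriv a b i g a s = 0
  /-- The boundary conditions at `t = b`. -/
  boundary_right : ∀ s ∈ Set.Ioo a b, ∀ i ∈ ε, tDeriv a b i g b s = 0

/-- Condition `(N_a)`: for each `h ∈ {1, …, n - 1}` at least `h` of the indices (those of `σ` and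
those of `ε` being counted separately) are smaller than `h`. -/
def ConditionNa (n : ℕ) (σ ε : Finset ℕ) : Prop :=
  ∀ h ∈ Finset.Icc 1 (n - 1), h ≤ (σ.filter (· < h)).card + (ε.filter (· < h)).card

/-- For `S = {σ₁, …, σ_k}`, the set `{σ₁ - q, …, σ_k - q} ∩ {0, …, n - q - 1}`. -/
def shiftedIndices (n q : ℕ) (S : Finset ℕ) : Finset ℕ :=
  (Finset.range (n - q)).filter (fun i => i + q ∈ S)

/-- The number of elements of `{σ₁ - q, …, σ_k - q} ∩ {0, …, n - q - 1}`: this is `c_q` for the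
indices at `a` and `d_q` for the indices at `b`. -/
def shiftedCount (n q : ℕ) (S : Finset ℕ) : ℕ :=
  (shiftedIndices n q S).card

/-- The indices of the boundary conditions satisfied by the `q`-th derivative: an index `i ≥ q`
becomes `i - q`, and an index `i < q` becomes `i - q + n`. -/
def derivIndices (n q : ℕ) (S : Finset ℕ) : Finset ℕ :=
  S.image (fun i => if q ≤ i then i - q else i + n - q)

/-- The least `i ∈ {0, …, n - 1}` which is not an index of the boundary conditions of the `q`-th
derivative: this is `α^q` for the indices at `a` and `β^q` for the indices at `b`. -/
noncomputable def firstFreeIndex (n q : ℕ) (S : Finset ℕ) : ℕ :=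
  sInf {i : ℕ | i < n ∧ i ∉ derivIndices n q S}

/-- The function `v_s^q(t) = ∂^q g / ∂t^q (t, s)` is strongly positive on `[a, b] × [a, b]`. -/
def StronglyPositive (n q : ℕ) (a b : ℝ) (σ ε : Finset ℕ) (g : ℝ → ℝ → ℝ) : Prop :=
  (∀ᵐ p : ℝ × ℝ, p ∈ Set.Ioo a b ×ˢ Set.Ioo a b → 0 < tDeriv a b q g p.1 p.2) ∧
  (∀ᵐ s : ℝ, s ∈ Set.Ioo a b →
    0 < tDeriv a b (firstFreeIndex n q σ) (tDeriv a b q g) a s) ∧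
  (∀ᵐ s : ℝ, s ∈ Set.Ioo a b →
    0 < (-1 : ℝ) ^ firstFreeIndex n q ε *
      tDeriv a b (firstFreeIndex n q ε) (tDeriv a b q g) b s)

/-- The function `v_s^q(t) = ∂^q g / ∂t^q (t, s)` is strongly negative on `[a, b] × [a, b]`. -/
def StronglyNegative (n q : ℕ) (a b : ℝ) (σ ε : Finset ℕ) (g : ℝ → ℝ → ℝ) : Prop :=
  (∀ᵐ p : ℝ × ℝ, p ∈ Set.Ioo a b ×ˢ Set.Ioo a b → tDeriv a b q g p.1 p.2 < 0) ∧
  (∀ᵐ s : ℝ, s ∈ Set.Ioo a b →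
    tDeriv a b (firstFreeIndex n q σ) (tDeriv a b q g) a s < 0) ∧
  (∀ᵐ s : ℝ, s ∈ Set.Ioo a b →
    (-1 : ℝ) ^ firstFreeIndex n q ε *
      tDeriv a b (firstFreeIndex n q ε) (tDeriv a b q g) b s < 0)

/-! Say the greatest index of `σ` is `q + c_q - 1`, and put `m = q + c_q`. Then `α^q = c_q`, so the
boundary derivative of `v_s^q` at `a` is `∂^m g/∂t^m (a, s)`, and every index of `σ` is below `m`.
The claim is that as `s → a` this derivative is asymptotic to `-(a - s)^(n-1-m) / (n-1-m)!`,
whatever `M` is. Its sign `(-1)^(n-m)` near `a` contradicts the excluded one.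

With `r = a - s`, let `X`, `Y` be the jets of `g(·, s)` at `a` and `b`, and `p(r)` the jet at `r` of
the fundamental solution. The unit jump gives `Y = Φ (X + p)`, `Φ` the flow from `a` to `b`. The
boundary conditions turn this into a square linear system determining `X + p` from the `p_i`, `i ∈
σ`. Since `p_i ~ r^(n-1-i) / (n-1-i)!`, those with `i < m` are `o(r^(n-1-m))`, so `X_m ~ -p_m`
(`tendsto_component_div_pow`). The end point `b` is symmetric, without the sign. -/

/-! ### Linear algebra of the two-point problem -/

section TwoPointLinearAlgebra

variable {n : ℕ}

/-- Functions whose leading powers at `0` are distinct: a term of strictly higher order than the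
comparison power `r ^ (n - 1 - m)` is negligible. -/
lemma tendsto_div_pow_of_lt {p : ℝ → Fin n → ℝ} {c : Fin n → ℝ} {l : Filter ℝ}
    (hl : l ≤ 𝓝[≠] 0)
    (hp : ∀ i : Fin n, Tendsto (fun r => p r i / r ^ (n - 1 - (i : ℕ))) l (𝓝 (c i)))
    {i m : Fin n} (him : i < m) :
    Tendsto (fun r => p r i / r ^ (n - 1 - (m : ℕ))) l (𝓝 0) := by
  have hr : Tendsto (fun r : ℝ => r ^ ((m : ℕ) - i)) l (𝓝 0) := by
    have h0 : Tendsto (fun r : ℝ => r ^ ((m : ℕ) - i)) (𝓝 0) (𝓝 (0 ^ ((m : ℕ) - i))) :=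
      (continuous_pow _).tendsto 0
    rw [zero_pow (by have : (i : ℕ) < m := him; omega)] at h0
    exact h0.mono_left (hl.trans nhdsWithin_le_nhds)
  have h := (hp i).mul hr
  rw [mul_zero] at h
  refine h.congr' ?_
  filter_upwards [hl self_mem_nhdsWithin] with r hr0
  have hr0 : r ≠ 0 := hr0
  have e : n - 1 - (i : ℕ) = (n - 1 - (m : ℕ)) + ((m : ℕ) - i) := by
    have : (i : ℕ) < m := him
    have := m.2
    omega
  rw [e, pow_add]
  field_simp

/-- Functions with distinct leading powers at `0` are linearly independent. -/
lemma eq_zero_of_eventually_sum_eq_zero {p : ℝ → Fin n → ℝ} {c : Fin n → ℝ} {l : Filter ℝ}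
    [l.NeBot] (hl : l ≤ 𝓝[≠] 0)
    (hp : ∀ i : Fin n, Tendsto (fun r => p r i / r ^ (n - 1 - (i : ℕ))) l (𝓝 (c i)))
    (hc : ∀ i, c i ≠ 0) {S : Finset (Fin n)} {w : S → ℝ}
    (hw : ∀ᶠ r in l, ∑ i : S, p r i * w i = 0) : w = 0 := by
  -- Induction on the leading exponent: after division by `r ^ k`, smaller indices vanish in the
  -- limit, and larger ones have zero weight by induction.
  have key : ∀ k : ℕ, ∀ i : S, n - 1 - (i : ℕ) = k → w i = 0 := by
    intro k
    induction k using Nat.strong_induction_on with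
    | _ k ih =>
      intro i hik
      have hlim : Tendsto (fun r => ∑ j : S, p r j / r ^ (n - 1 - (i : ℕ)) * w j) l
          (𝓝 (∑ j : S, if j = i then c i * w i else 0)) := by
        refine tendsto_finsetSum _ fun j _ => ?_
        rcases lt_trichotomy (j : Fin n) (i : Fin n) with h | h | h
        · have hne : j ≠ i := fun e => by simp [e] at h
          simpa [hne] using (tendsto_div_pow_of_lt hl hp h).mul_const (w j)
        · have hji : j = i := Subtype.ext h
          subst hji
          simpa using (hp j).mul_const (w j)
        · have hne : j ≠ i := fun e => by simp [e] at h
          have hlt : (i : Fin n).val < (j : Fin n).val := h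
          have hjn := (j : Fin n).2
          simp [hne, ih (n - 1 - ((j : Fin n) : ℕ)) (by omega) j rfl]
      have hzero : Tendsto (fun r => ∑ j : S, p r j / r ^ (n - 1 - (i : ℕ)) * w j) l (𝓝 0) := by
        refine tendsto_const_nhds.congr' ?_
        filter_upwards [hw] with r hr
        have : ∑ j : S, p r j / r ^ (n - 1 - (i : ℕ)) * w j
            = (∑ j : S, p r j * w j) / r ^ (n - 1 - (i : ℕ)) := by
          rw [Finset.sum_div]
          exact Finset.sum_congr rfl fun j _ => by ring
        rw [this, hr, zero_div]
      have := tendsto_nhds_unique hlim hzero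
      rw [Finset.sum_ite_eq' Finset.univ i] at this
      simpa [hc] using this
  exact funext fun i => key _ i rfl

/-- If `Y = Φ (X + p)`, where `X` vanishes on `S`, `Y` vanishes on `T` and `#S + #T = n`, then for
every `m` above all elements of `S` the component `X m` behaves as `-p m`. -/
lemma tendsto_component_div_pow {p X Y : ℝ → Fin n → ℝ} {c : Fin n → ℝ} {l : Filter ℝ}
    [l.NeBot] (hl : l ≤ 𝓝[≠] 0)
    (hp : ∀ i : Fin n, Tendsto (fun r => p r i / r ^ (n - 1 - (i : ℕ))) l (𝓝 (c i)))
    (hc : ∀ i, c i ≠ 0) {S T : Finset (Fin n)} (hST : S.card + T.card = n)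
    (Φ : (Fin n → ℝ) →ₗ[ℝ] (Fin n → ℝ)) (hΦ : Function.Surjective Φ)
    (hX : ∀ᶠ r in l, ∀ i ∈ S, X r i = 0) (hY : ∀ᶠ r in l, ∀ i ∈ T, Y r i = 0)
    (hXY : ∀ᶠ r in l, Y r = Φ (X r + p r)) {m : Fin n} (hm : ∀ i ∈ S, i < m) :
    Tendsto (fun r => X r m / r ^ (n - 1 - (m : ℕ))) l (𝓝 (-c m)) := by
  let R : (Fin n → ℝ) →ₗ[ℝ] (S → ℝ) × (T → ℝ) :=
    (LinearMap.funLeft ℝ ℝ (fun i : S => (i : Fin n))).prod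
      ((LinearMap.funLeft ℝ ℝ (fun i : T => (i : Fin n))) ∘ₗ Φ)
  have hR : ∀ᶠ r in l, R (X r + p r) = (fun i : S => p r i, 0) := by
    filter_upwards [hX, hY, hXY] with r h1 h2 h3
    refine Prod.ext ?_ ?_
    · funext i
      simp [R, LinearMap.funLeft_apply, h1 i i.2]
    · funext i
      change Φ (X r + p r) i = 0
      rw [← h3]
      exact h2 i i.2
  -- Unique solvability comes from existence for all small `r`: a functional killing the range of
  -- `R` kills every `(p r|S, 0)`, and the `p i` are independent.
  have hsurj : LinearMap.range R = ⊤ := by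
    by_contra hne
    obtain ⟨f, hf0, hf⟩ := Submodule.exists_le_ker_of_lt_top _ (lt_top_iff_ne_top.2 hne)
    have hfR : ∀ x, f (R x) = 0 := fun x => hf ⟨x, rfl⟩
    have hinl : ∀ x : S → ℝ, f (x, 0) = 0 := by
      have hsum : ∀ x : S → ℝ, f (x, 0) = ∑ i : S, x i * f (Pi.single i 1, 0) := fun x => by
        have := LinearMap.pi_apply_eq_sum_univ (f ∘ₗ LinearMap.inl ℝ (S → ℝ) (T → ℝ)) x
        simp only [LinearMap.comp_apply, LinearMap.inl_apply, smul_eq_mul] at this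
        rw [this]
        refine Finset.sum_congr rfl fun i _ => ?_
        congr 3
        ext j
        simp [Pi.single_apply, eq_comm]
      have hw := eq_zero_of_eventually_sum_eq_zero (w := fun i : S => f (Pi.single i 1, 0))
        hl hp hc (by
          filter_upwards [hR] with r hr
          rw [← hsum (fun i : S => p r i), ← hr, hfR])
      intro x
      rw [hsum]
      exact Finset.sum_eq_zero fun i _ => by rw [congrFun hw i]; simp
    -- Lift `y` through `Φ` to some `x`; then `R x` and `(0, y)` differ by a vector `(·, 0)`,
    -- already killed.
    have hinr : ∀ y : T → ℝ, f (0, y) = 0 := by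
      intro y
      obtain ⟨z, hz⟩ := (LinearMap.funLeft_surjective_of_injective ℝ ℝ
        (fun i : T => (i : Fin n)) Subtype.val_injective) y
      obtain ⟨x, rfl⟩ := hΦ z
      have h1 := hfR x
      have h2 : R x = ((R x).1, 0) + (0, y) := by
        rw [← hz]
        refine Prod.ext ?_ ?_ <;> simp [R]
      rw [h2, map_add, hinl, zero_add] at h1
      exact h1
    apply hf0
    ext x
    · simp [hinl]
    · simp [hinr]
  have hbij : Function.Injective R := by
    rw [LinearMap.injective_iff_surjective_of_finrank_eq_finrank]
    · exact LinearMap.range_eq_top.1 hsurj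
    · simp [hST]
  let e := LinearEquiv.ofBijective R ⟨hbij, LinearMap.range_eq_top.1 hsurj⟩
  let F : (S → ℝ) →ₗ[ℝ] ℝ :=
    (LinearMap.proj m ∘ₗ e.symm.toLinearMap) ∘ₗ LinearMap.inl ℝ (S → ℝ) (T → ℝ)
  have hF : ∀ᶠ r in l, X r m / r ^ (n - 1 - (m : ℕ)) =
      (∑ i : S, p r i / r ^ (n - 1 - (m : ℕ)) * F (fun j => if i = j then 1 else 0)) -
        p r m / r ^ (n - 1 - (m : ℕ)) := by
    filter_upwards [hR] with r hr
    have h1 : X r + p r = e.symm (fun i : S => p r i, 0) := by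
      rw [LinearEquiv.eq_symm_apply]; exact hr
    have h2 : X r m + p r m = F (fun i : S => p r i) := congrFun h1 m
    rw [LinearMap.pi_apply_eq_sum_univ] at h2
    rw [eq_sub_iff_add_eq, ← add_div, h2, Finset.sum_div]
    exact Finset.sum_congr rfl fun i _ => by rw [smul_eq_mul]; ring
  have hlim : Tendsto (fun r => (∑ i : S, p r i / r ^ (n - 1 - (m : ℕ)) *
      F (fun j => if i = j then 1 else 0)) - p r m / r ^ (n - 1 - (m : ℕ))) l
      (𝓝 ((∑ i : S, 0 * F (fun j => if i = j then 1 else 0)) - c m)) :=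
    (tendsto_finsetSum _ fun (i : S) _ =>
      (tendsto_div_pow_of_lt hl hp (hm i i.2)).mul_const _).sub (hp m)
  simp only [zero_mul, Finset.sum_const_zero, zero_sub] at hlim
  exact hlim.congr' (hF.mono fun r hr => hr.symm)

end TwoPointLinearAlgebra

/-! ### Companion flow and fundamental solution -/

section Companion

variable {n : ℕ}

/-- The companion operator of `u⁽ⁿ⁾ + M u = 0`. -/
noncomputable def companion (n : ℕ) (M : ℝ) : (Fin n → ℝ) →L[ℝ] (Fin n → ℝ) :=
  LinearMap.toContinuousLinearMap
    { toFun := fun x i => if h : (i : ℕ) + 1 < n then x ⟨i + 1, h⟩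
        else -M * x ⟨0, i.pos⟩
      map_add' := fun x y => by ext i; simp only [Pi.add_apply]; split_ifs <;> ring
      map_smul' := fun r x => by
        ext i; simp only [Pi.smul_apply, smul_eq_mul, RingHom.id_apply]; split_ifs <;> ring }

lemma companion_apply (M : ℝ) (x : Fin n → ℝ) (i : Fin n) :
    companion n M x i = if h : (i : ℕ) + 1 < n then x ⟨i + 1, h⟩ else -M * x ⟨0, i.pos⟩ := rfl

/-- The flow of the first order system `U' = B U` with `B` the companion operator. -/
noncomputable def flow (n : ℕ) (M r : ℝ) : (Fin n → ℝ) →L[ℝ] (Fin n → ℝ) :=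
  NormedSpace.exp (r • companion n M)

lemma flow_zero (M : ℝ) : flow n M 0 = 1 := by simp [flow, NormedSpace.exp_zero]

lemma flow_add (M r r' : ℝ) : flow n M (r + r') = flow n M r * flow n M r' := by
  let _ : NormedAlgebra ℚ ((Fin n → ℝ) →L[ℝ] (Fin n → ℝ)) := NormedAlgebra.restrictScalars ℚ ℝ _
  unfold flow
  rw [add_smul, NormedSpace.exp_add_of_commute]
  exact ((Commute.refl _).smul_left _).smul_right _

lemma flow_flow (M r r' : ℝ) (x : Fin n → ℝ) :
    flow n M r (flow n M r' x) = flow n M (r + r') x := by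
  rw [flow_add]; rfl

lemma flow_surjective (M r : ℝ) : Function.Surjective (flow n M r) := fun x =>
  ⟨flow n M (-r) x, by rw [flow_flow, add_neg_cancel, flow_zero]; rfl⟩

lemma hasDerivAt_flow (M r : ℝ) :
    HasDerivAt (flow n M) (flow n M r * companion n M) r :=
  hasDerivAt_exp_smul_const (companion n M) r

lemma hasDerivAt_flow' (M r : ℝ) :
    HasDerivAt (flow n M) (companion n M * flow n M r) r :=
  hasDerivAt_exp_smul_const' (companion n M) r

/-- The last vector of the canonical basis. -/
def lastVec (n : ℕ) : Fin n → ℝ := fun i => if (i : ℕ) + 1 = n then 1 else 0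

lemma hasDerivAt_flow_lastVec (M r : ℝ) {i : Fin n} (hi : (i : ℕ) + 1 < n) :
    HasDerivAt (fun r => flow n M r (lastVec n) i) (flow n M r (lastVec n) ⟨i + 1, hi⟩) r := by
  have h := (hasDerivAt_flow' (n := n) M r).clm_apply (hasDerivAt_const r (lastVec n))
  have h := hasDerivAt_pi.1 h i
  simpa [companion_apply, hi] using h

lemma tendsto_flow_lastVec (M : ℝ) (i : Fin n) :
    Tendsto (fun r => flow n M r (lastVec n) i) (𝓝[≠] 0) (𝓝 (lastVec n i)) := by
  have h := (hasDerivAt_flow' (n := n) M 0).clm_apply (hasDerivAt_const 0 (lastVec n))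
  have h := (hasDerivAt_pi.1 h i).continuousAt.tendsto
  simp only [flow_zero] at h
  exact h.mono_left nhdsWithin_le_nhds

/-- The last component tends to `1`; each earlier one vanishes at `0` and has the next as
derivative, so L'Hôpital raises the exponent by one each time. -/
lemma tendsto_flow_lastVec_div_pow (M : ℝ) (i : Fin n) :
    Tendsto (fun r => flow n M r (lastVec n) i / r ^ (n - 1 - (i : ℕ))) (𝓝[≠] 0)
      (𝓝 (((n - 1 - (i : ℕ)).factorial : ℝ)⁻¹)) := by
  obtain ⟨j, hj⟩ : ∃ j, n - 1 - (i : ℕ) = j := ⟨_, rfl⟩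
  rw [hj]
  induction j generalizing i with
  | zero =>
    have h := tendsto_flow_lastVec M i
    rw [lastVec, if_pos (by omega)] at h
    simpa using h
  | succ j ih =>
    have hi : (i : ℕ) + 1 < n := by omega
    have hf := tendsto_flow_lastVec M i
    rw [lastVec, if_neg (by omega)] at hf
    have hg : Tendsto (fun r : ℝ => r ^ (j + 1)) (𝓝[≠] 0) (𝓝 0) := by
      have := (continuous_pow (M := ℝ) (j + 1)).tendsto 0
      rw [zero_pow (by omega)] at this
      exact this.mono_left nhdsWithin_le_nhds
    refine HasDerivAt.lhopital_zero_nhdsNE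
      (f' := fun r => flow n M r (lastVec n) ⟨i + 1, hi⟩)
      (g' := fun r => ((j + 1 : ℕ) : ℝ) * r ^ j)
      (Eventually.of_forall fun r => hasDerivAt_flow_lastVec M r hi)
      (Eventually.of_forall fun r => by simpa using hasDerivAt_pow (j + 1) r) ?_ hf hg ?_
    · filter_upwards [self_mem_nhdsWithin] with r hr
      have hr : r ≠ 0 := hr
      positivity
    · have h := (ih ⟨i + 1, hi⟩ (by simp only; omega)).const_mul ((j + 1 : ℕ) : ℝ)⁻¹
      rw [Nat.factorial_succ, Nat.cast_mul, mul_inv]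
      refine h.congr fun r => ?_
      rw [inv_mul_eq_div, div_div, mul_comm (r ^ j)]

end Companion

/-! ### Jets of the Green's function -/

section Jet

/-- The vector of the derivatives of order less than `n` of `g(·, s)` at `t`. -/
noncomputable def jet (n : ℕ) (a b : ℝ) (g : ℝ → ℝ → ℝ) (s t : ℝ) : Fin n → ℝ :=
  fun i => tDeriv a b i g t s

lemma tDeriv_tDeriv (a b : ℝ) (i j : ℕ) (g : ℝ → ℝ → ℝ) (t s : ℝ) :
    tDeriv a b i (tDeriv a b j g) t s = tDeriv a b (j + i) g t s := by
  unfold tDeriv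
  rw [iteratedDerivWithin_eq_iterate, iteratedDerivWithin_eq_iterate, add_comm j i,
    Function.iterate_add_apply]
  exact congrArg (fun f => (fun g : ℝ → ℝ => derivWithin g (Set.Icc a b))^[i] f t)
    (funext fun x => iteratedDerivWithin_eq_iterate)

/-- A function of zero derivative on `[a, b]` off the point `s` is constant on each side of `s`. -/
lemma eq_of_hasDerivWithinAt_zero {E : Type*} [NormedAddCommGroup E] [NormedSpace ℝ E]
    {J : ℝ → E} {A : Set ℝ} (hA : Convex ℝ A) (hJ : ∀ t ∈ A, HasDerivWithinAt J 0 A t)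
    {x y : ℝ} (hx : x ∈ A) (hy : y ∈ A) : J x = J y := by
  have h := hA.norm_image_sub_le_of_norm_hasDerivWithin_le (f' := fun _ => 0) (C := 0) hJ
    (by simp) hy hx
  rw [zero_mul] at h
  exact sub_eq_zero.1 (norm_le_zero_iff.1 h)

variable {n : ℕ} {a b M : ℝ} {σ ε : Finset ℕ} {g : ℝ → ℝ → ℝ}

namespace IsGreenFunction

lemma hasDerivWithinAt_tDeriv (hab : a < b) (hg : IsGreenFunction n a b M σ ε g) {s t : ℝ}
    (hs : s ∈ Set.Ioo a b) (ht : t ∈ Set.Icc a b) (hts : t ≠ s) {i : ℕ} (hi : i < n) :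
    HasDerivWithinAt (fun x => tDeriv a b i g x s) (tDeriv a b (i + 1) g t s)
      (Set.Icc a b) t := by
  have hs' := Set.Ioo_subset_Icc_self hs
  have hcd : ContDiffWithinAt ℝ (n : ℕ∞) (fun x => g x s) (Set.Icc a b) t := by
    rcases lt_or_gt_of_ne hts with h | h
    · refine (hg.contDiffOn_upper s hs' t ⟨ht.1, h⟩).mono_of_mem_nhdsWithin ?_
      filter_upwards [self_mem_nhdsWithin, mem_nhdsWithin_of_mem_nhds (Iio_mem_nhds h)]
        with x hx hxs using ⟨hx.1, hxs⟩
    · refine (hg.contDiffOn_lower s hs' t ⟨h, ht.2⟩).mono_of_mem_nhdsWithin ?_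
      filter_upwards [self_mem_nhdsWithin, mem_nhdsWithin_of_mem_nhds (Ioi_mem_nhds h)]
        with x hx hxs using ⟨hxs, hx.2⟩
  have hd := hcd.differentiableWithinAt_iteratedDerivWithin (m := i) (by exact_mod_cast hi)
    (by rw [Set.insert_eq_of_mem ht]; exact uniqueDiffOn_Icc hab)
  have := hd.hasDerivWithinAt
  unfold tDeriv
  rw [iteratedDerivWithin_succ]
  exact this

lemma hasDerivWithinAt_jet (hab : a < b) (hg : IsGreenFunction n a b M σ ε g) {s t : ℝ}
    (hs : s ∈ Set.Ioo a b) (ht : t ∈ Set.Icc a b) (hts : t ≠ s) :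
    HasDerivWithinAt (jet n a b g s) (companion n M (jet n a b g s t)) (Set.Icc a b) t := by
  rw [hasDerivWithinAt_pi]
  intro i
  have h := hg.hasDerivWithinAt_tDeriv hab hs ht hts i.2
  rw [companion_apply]
  split_ifs with hi
  · exact h
  · have hin : (i : ℕ) + 1 = n := by have := i.2; omega
    have he := hg.equation s hs t ht hts
    have h0 : tDeriv a b 0 g t s = g t s := by simp [tDeriv]
    rw [hin] at h
    have : tDeriv a b n g t s = -M * jet n a b g s t ⟨0, i.pos⟩ := by
      change _ = -M * tDeriv a b 0 g t s
      rw [h0]; linarith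
    rw [← this]
    exact h

/-- Variation of constants: transporting the jet back to time `0` cancels the equation, leaving only
the jump at `s`. -/
lemma hasDerivWithinAt_flow_jet (hab : a < b) (hg : IsGreenFunction n a b M σ ε g) {s t : ℝ}
    (hs : s ∈ Set.Ioo a b) (ht : t ∈ Set.Icc a b) (hts : t ≠ s) :
    HasDerivWithinAt (fun t => flow n M (-t) (jet n a b g s t)) 0 (Set.Icc a b) t := by
  have h1 : HasDerivAt (fun t => flow n M (-t)) (-(flow n M (-t) * companion n M)) t := by
    have := (hasDerivAt_flow (n := n) M (-t)).scomp t (hasDerivAt_neg t)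
    rwa [neg_one_smul] at this
  have h := h1.hasDerivWithinAt.clm_apply (hg.hasDerivWithinAt_jet hab hs ht hts)
  exact h.congr_deriv (neg_add_cancel (flow n M (-t) (companion n M (jet n a b g s t))))

/-- The jets at the two end points determine each other, up to the jump on the diagonal. -/
lemma flow_jet_right (hn : 2 ≤ n) (hab : a < b) (hg : IsGreenFunction n a b M σ ε g) {s : ℝ}
    (hs : s ∈ Set.Ioo a b) :
    flow n M (-b) (jet n a b g s b) =
      flow n M (-a) (jet n a b g s a) + flow n M (-s) (lastVec n) := by
  obtain ⟨l, hl, hr⟩ := hg.jump s hs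
  have hIcc : Set.Icc a b ∈ 𝓝 s := Icc_mem_nhds hs.1 hs.2
  -- The left limit of the jet at `s`; the right limit is `v + lastVec n`, as only the derivative of
  -- order `n - 1` jumps.
  let v : Fin n → ℝ := fun i => if (i : ℕ) + 1 = n then l else tDeriv a b i g s s
  have hcont : ∀ i : ℕ, i ≤ n - 2 →
      Tendsto (fun t => tDeriv a b i g t s) (𝓝 s) (𝓝 (tDeriv a b i g s s)) := by
    intro i hi
    have h := (hg.contDiffOn_square s (Set.Ioo_subset_Icc_self hs)).continuousOn_iteratedDerivWithin
      (m := i) (by exact_mod_cast hi) (uniqueDiffOn_Icc hab)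
    exact h.continuousAt hIcc
  have hleft : Tendsto (jet n a b g s) (𝓝[<] s) (𝓝 v) := by
    rw [tendsto_pi_nhds]
    intro i
    by_cases hi : (i : ℕ) + 1 = n
    · simp only [jet, v, if_pos hi]
      rwa [show (i : ℕ) = n - 1 by omega]
    · simp only [jet, v, if_neg hi]
      exact (hcont i (by have := i.2; omega)).mono_left nhdsWithin_le_nhds
  have hright : Tendsto (jet n a b g s) (𝓝[>] s) (𝓝 (v + lastVec n)) := by
    rw [tendsto_pi_nhds]
    intro i
    by_cases hi : (i : ℕ) + 1 = n
    · simp only [jet, v, lastVec, Pi.add_apply, if_pos hi]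
      rwa [show (i : ℕ) = n - 1 by omega]
    · simp only [jet, v, lastVec, Pi.add_apply, if_neg hi, add_zero]
      exact (hcont i (by have := i.2; omega)).mono_left nhdsWithin_le_nhds
  have hflow : Tendsto (fun t => flow n M (-t)) (𝓝 s) (𝓝 (flow n M (-s))) :=
    ((hasDerivAt_flow (n := n) M (-s)).continuousAt.tendsto.comp
      (continuous_neg.tendsto s))
  have hJl : Tendsto (fun t => flow n M (-t) (jet n a b g s t)) (𝓝[<] s)
      (𝓝 (flow n M (-s) v)) :=
    (isBoundedBilinearMap_apply.continuous.tendsto (flow n M (-s), v)).comp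
      ((hflow.mono_left nhdsWithin_le_nhds).prodMk_nhds hleft)
  have hJr : Tendsto (fun t => flow n M (-t) (jet n a b g s t)) (𝓝[>] s)
      (𝓝 (flow n M (-s) (v + lastVec n))) :=
    (isBoundedBilinearMap_apply.continuous.tendsto (flow n M (-s), v + lastVec n)).comp
      ((hflow.mono_left nhdsWithin_le_nhds).prodMk_nhds hright)
  have hel : flow n M (-a) (jet n a b g s a) = flow n M (-s) v := by
    refine tendsto_nhds_unique (tendsto_const_nhds.congr' ?_) hJl
    filter_upwards [Ioo_mem_nhdsLT hs.1] with t ht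
    have hsub : Set.Ico a s ⊆ Set.Icc a b := fun x hx => ⟨hx.1, hx.2.le.trans hs.2.le⟩
    exact eq_of_hasDerivWithinAt_zero (J := fun t => flow n M (-t) (jet n a b g s t))
      (convex_Ico a s)
      (fun x hx => (hg.hasDerivWithinAt_flow_jet hab hs (hsub hx) hx.2.ne).mono hsub)
      ⟨le_rfl, hs.1⟩ ⟨ht.1.le, ht.2⟩
  have her : flow n M (-b) (jet n a b g s b) = flow n M (-s) (v + lastVec n) := by
    refine tendsto_nhds_unique (tendsto_const_nhds.congr' ?_) hJr
    filter_upwards [Ioo_mem_nhdsGT hs.2] with t ht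
    have hsub : Set.Ioc s b ⊆ Set.Icc a b := fun x hx => ⟨hs.1.le.trans hx.1.le, hx.2⟩
    exact eq_of_hasDerivWithinAt_zero (J := fun t => flow n M (-t) (jet n a b g s t))
      (convex_Ioc s b)
      (fun x hx => (hg.hasDerivWithinAt_flow_jet hab hs (hsub hx) hx.1.ne').mono hsub)
      ⟨hs.2, le_rfl⟩ ⟨ht.1, ht.2.le⟩
  rw [hel, her, map_add]

/-! ### Asymptotics and signs at the end points -/

/-- The first derivative at `a` above those of the boundary conditions behaves, as `s → a`, as that
of the fundamental solution, up to the sign. -/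
lemma tendsto_tDeriv_left (hn : 2 ≤ n) (hab : a < b) (hg : IsGreenFunction n a b M σ ε g)
    (hσ : σ ⊆ Finset.range n) (hε : ε ⊆ Finset.range n) (hcard : σ.card + ε.card = n)
    {m : ℕ} (hmn : m < n) (hm : ∀ i ∈ σ, i < m) :
    Tendsto (fun r => tDeriv a b m g a (a - r) / r ^ (n - 1 - m)) (𝓝[<] 0)
      (𝓝 (-((n - 1 - m).factorial : ℝ)⁻¹)) := by
  have hl : (𝓝[<] (0 : ℝ)) ≤ 𝓝[≠] 0 := nhdsWithin_mono _ fun x hx => ne_of_lt hx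
  have hmem : ∀ᶠ r in 𝓝[<] (0 : ℝ), a - r ∈ Set.Ioo a b := by
    filter_upwards [Ioo_mem_nhdsLT (show a - b < 0 by linarith)] with r hr
    exact ⟨by linarith [hr.2], by linarith [hr.1]⟩
  exact tendsto_component_div_pow (p := fun r => flow n M r (lastVec n))
    (X := fun r => jet n a b g (a - r) a) (Y := fun r => jet n a b g (a - r) b) hl
    (fun i => (tendsto_flow_lastVec_div_pow M i).mono_left hl) (fun i => by positivity)
    (S := σ.attachFin fun i hi => Finset.mem_range.1 (hσ hi))
    (T := ε.attachFin fun i hi => Finset.mem_range.1 (hε hi))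
    (by simpa using hcard) (flow n M (b - a)).toLinearMap (flow_surjective M _)
    (hmem.mono fun r hr i hi =>
      hg.boundary_left _ hr i (Finset.mem_attachFin _ |>.1 hi))
    (hmem.mono fun r hr i hi =>
      hg.boundary_right _ hr i (Finset.mem_attachFin _ |>.1 hi))
    (hmem.mono fun r hr => by
      have h := congrArg (flow n M b) (hg.flow_jet_right hn hab hr)
      rw [map_add, flow_flow, flow_flow, flow_flow, add_neg_cancel, flow_zero] at h
      rw [map_add]
      change _ = flow n M (b - a) _ + flow n M (b - a) (flow n M r (lastVec n))
      rw [flow_flow, show b - a + r = b + -(a - r) by ring, sub_eq_add_neg b a]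
      exact h)
    (m := ⟨m, hmn⟩) (fun i hi => hm i (Finset.mem_attachFin _ |>.1 hi))

/-- The first derivative at `b` above those of the boundary conditions behaves, as `s → b`, as that
of the fundamental solution. -/
lemma tendsto_tDeriv_right (hn : 2 ≤ n) (hab : a < b) (hg : IsGreenFunction n a b M σ ε g)
    (hσ : σ ⊆ Finset.range n) (hε : ε ⊆ Finset.range n) (hcard : σ.card + ε.card = n)
    {m : ℕ} (hmn : m < n) (hm : ∀ i ∈ ε, i < m) :
    Tendsto (fun r => tDeriv a b m g b (b - r) / r ^ (n - 1 - m)) (𝓝[>] 0)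
      (𝓝 ((n - 1 - m).factorial : ℝ)⁻¹) := by
  have hl : (𝓝[>] (0 : ℝ)) ≤ 𝓝[≠] 0 := nhdsWithin_mono _ fun x hx => ne_of_gt hx
  have hmem : ∀ᶠ r in 𝓝[>] (0 : ℝ), b - r ∈ Set.Ioo a b := by
    filter_upwards [Ioo_mem_nhdsGT (show 0 < b - a by linarith)] with r hr
    exact ⟨by linarith [hr.2], by linarith [hr.1]⟩
  -- Going from `b` to `a` the jump is subtracted; negating both jets restores the form `Y = Φ (X +
  -- p)`, now with `r = b - s`.
  have h := tendsto_component_div_pow (p := fun r => flow n M r (lastVec n))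
    (X := fun r => -jet n a b g (b - r) b) (Y := fun r => -jet n a b g (b - r) a) hl
    (fun i => (tendsto_flow_lastVec_div_pow M i).mono_left hl) (fun i => by positivity)
    (S := ε.attachFin fun i hi => Finset.mem_range.1 (hε hi))
    (T := σ.attachFin fun i hi => Finset.mem_range.1 (hσ hi))
    (by simpa [add_comm] using hcard) (flow n M (a - b)).toLinearMap (flow_surjective M _)
    (hmem.mono fun r hr i hi => neg_eq_zero.2
      (hg.boundary_right _ hr i (Finset.mem_attachFin _ |>.1 hi)))
    (hmem.mono fun r hr i hi => neg_eq_zero.2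
      (hg.boundary_left _ hr i (Finset.mem_attachFin _ |>.1 hi)))
    (hmem.mono fun r hr => by
      have h := congrArg (flow n M a) (hg.flow_jet_right hn hab hr)
      rw [map_add, flow_flow, flow_flow, flow_flow, add_neg_cancel, flow_zero] at h
      rw [map_add, map_neg]
      change _ = -flow n M (a - b) _ + flow n M (a - b) (flow n M r (lastVec n))
      rw [flow_flow, show a - b + r = a + -(b - r) by ring, sub_eq_add_neg a b, h]
      simp)
    (m := ⟨m, hmn⟩) (fun i hi => hm i (Finset.mem_attachFin _ |>.1 hi))
  have h' := h.neg
  rw [neg_neg] at h'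
  refine h'.congr fun r => ?_
  simp [jet, neg_div]

/-- The sign of the first free derivative at `a`, for `s` near `a`. -/
lemma eventually_tDeriv_left_pos (hn : 2 ≤ n) (hab : a < b) (hg : IsGreenFunction n a b M σ ε g)
    (hσ : σ ⊆ Finset.range n) (hε : ε ⊆ Finset.range n) (hcard : σ.card + ε.card = n)
    {m : ℕ} (hmn : m < n) (hm : ∀ i ∈ σ, i < m) :
    ∀ᶠ s in 𝓝[>] a, 0 < (-1 : ℝ) ^ (n - m) * tDeriv a b m g a s := by
  have h := (hg.tendsto_tDeriv_left hn hab hσ hε hcard hmn hm).eventually_lt_const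
    (u := 0) (neg_lt_zero.2 (by positivity))
  have hsub : Tendsto (fun s => a - s) (𝓝[>] a) (𝓝[<] 0) := by
    refine tendsto_nhdsWithin_iff.2 ⟨?_, ?_⟩
    · have : Tendsto (fun s => a - s) (𝓝 a) (𝓝 (a - a)) :=
        (continuous_const.sub continuous_id).tendsto a
      rw [sub_self] at this
      exact this.mono_left nhdsWithin_le_nhds
    · filter_upwards [self_mem_nhdsWithin] with s hs
      exact sub_neg.2 (Set.mem_Ioi.1 hs)
  filter_upwards [hsub.eventually h, self_mem_nhdsWithin] with s hs hsa
  rw [sub_sub_cancel] at hs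
  have hsa : 0 < s - a := sub_pos.2 hsa
  -- Here `a - s < 0`: this sign and the minus of the limit combine to `(-1) ^ (n - m)`.
  have hpow : (a - s) ^ (n - 1 - m) = (-1) ^ (n - 1 - m) * (s - a) ^ (n - 1 - m) := by
    rw [← mul_pow]; congr 1; ring
  have hP : 0 < (s - a) ^ (n - 1 - m) := by positivity
  have hq : tDeriv a b m g a s / (a - s) ^ (n - 1 - m) =
      -((-1 : ℝ) ^ (n - m) * tDeriv a b m g a s / (s - a) ^ (n - 1 - m)) := by
    rw [hpow, show n - m = (n - 1 - m) + 1 by omega, pow_succ]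
    rcases neg_one_pow_eq_or ℝ (n - 1 - m) with e | e <;> rw [e] <;> field_simp
  rw [hq, neg_lt_zero] at hs
  exact (div_pos_iff_of_pos_right hP).1 hs

/-- The sign of the first free derivative at `b`, for `s` near `b`. -/
lemma eventually_tDeriv_right_pos (hn : 2 ≤ n) (hab : a < b) (hg : IsGreenFunction n a b M σ ε g)
    (hσ : σ ⊆ Finset.range n) (hε : ε ⊆ Finset.range n) (hcard : σ.card + ε.card = n)
    {m : ℕ} (hmn : m < n) (hm : ∀ i ∈ ε, i < m) :
    ∀ᶠ s in 𝓝[<] b, 0 < tDeriv a b m g b s := by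
  have h := (hg.tendsto_tDeriv_right hn hab hσ hε hcard hmn hm).eventually_const_lt
    (u := 0) (by positivity)
  have hsub : Tendsto (fun s => b - s) (𝓝[<] b) (𝓝[>] 0) := by
    refine tendsto_nhdsWithin_iff.2 ⟨?_, ?_⟩
    · have : Tendsto (fun s => b - s) (𝓝 b) (𝓝 (b - b)) :=
        (continuous_const.sub continuous_id).tendsto b
      rw [sub_self] at this
      exact this.mono_left nhdsWithin_le_nhds
    · filter_upwards [self_mem_nhdsWithin] with s hs
      exact sub_pos.2 (Set.mem_Iio.1 hs)
  filter_upwards [hsub.eventually h, self_mem_nhdsWithin] with s hs hsb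
  rw [sub_sub_cancel] at hs
  have hsb : 0 < b - s := sub_pos.2 hsb
  exact (div_pos_iff_of_pos_right (by positivity)).1 hs

end IsGreenFunction

end Jet

/-! ### First free index -/

section Indices

lemma lt_of_isGreatest {n q : ℕ} {S : Finset ℕ} (hc : 1 ≤ shiftedCount n q S)
    (hS : IsGreatest (S : Set ℕ) (q + shiftedCount n q S - 1)) :
    ∀ i ∈ S, i < q + shiftedCount n q S := fun i hi => by
  have := hS.2 hi
  omega

/-- If the greatest index is `q + c - 1`, where `c` indices are at least `q`, then the first free
index of the `q`-th derivative is `c`. -/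
lemma firstFreeIndex_eq_shiftedCount {n q : ℕ} {S : Finset ℕ} (hc : 1 ≤ shiftedCount n q S)
    (hcn : shiftedCount n q S < n - q)
    (hS : IsGreatest (S : Set ℕ) (q + shiftedCount n q S - 1)) :
    firstFreeIndex n q S = shiftedCount n q S := by
  have hlt := lt_of_isGreatest hc hS
  have hsub : shiftedIndices n q S ⊆ Finset.range (shiftedCount n q S) := fun i hi => by
    have := hlt _ (Finset.mem_filter.1 hi).2
    exact Finset.mem_range.2 (by omega)
  -- The `c` shifted indices all lie below `c`, so they fill `{0, …, c - 1}`.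
  have heq : shiftedIndices n q S = Finset.range (shiftedCount n q S) :=
    Finset.eq_of_subset_of_card_le hsub (by simp [shiftedCount])
  refine (IsLeast.csInf_eq ⟨⟨by omega, ?_⟩, ?_⟩)
  -- An index `i < q` becomes `i + n - q ≥ n - q > c`, so it cannot occupy `c`.
  · intro hmem
    obtain ⟨i, hi, hie⟩ := Finset.mem_image.1 hmem
    have := hlt i hi
    split_ifs at hie <;> omega
  · rintro j ⟨-, hj⟩
    by_contra! hlt'
    have hmem : j ∈ shiftedIndices n q S := heq ▸ Finset.mem_range.2 hlt'
    exact hj (Finset.mem_image.2 ⟨j + q, (Finset.mem_filter.1 hmem).2, by simp⟩)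

end Indices

/-! ### From almost every `s` to an `s` near an end point -/

lemma exists_mem_Ioo_of_ae_of_eventually_nhdsGT {a b : ℝ} (hab : a < b) {P Q : ℝ → Prop}
    (hP : ∀ᵐ s : ℝ, s ∈ Set.Ioo a b → P s) (hQ : ∀ᶠ s in 𝓝[>] a, Q s) : ∃ s, P s ∧ Q s := by
  obtain ⟨c, hac, hc⟩ := (mem_nhdsGT_iff_exists_Ioo_subset' hab).1
    (inter_mem hQ (Ioo_mem_nhdsGT hab))
  have hpos : (volume (Set.Ioo a c)) ≠ 0 := by
    rw [Real.volume_Ioo]; simpa using hac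
  obtain ⟨s, hs, hPs⟩ := (frequently_ae_mem_iff.2 hpos).and_eventually hP |>.exists
  exact ⟨s, hPs (hc hs).2, (hc hs).1⟩

lemma exists_mem_Ioo_of_ae_of_eventually_nhdsLT {a b : ℝ} (hab : a < b) {P Q : ℝ → Prop}
    (hP : ∀ᵐ s : ℝ, s ∈ Set.Ioo a b → P s) (hQ : ∀ᶠ s in 𝓝[<] b, Q s) : ∃ s, P s ∧ Q s := by
  obtain ⟨c, hcb, hc⟩ := (mem_nhdsLT_iff_exists_Ioo_subset' hab).1
    (inter_mem hQ (Ioo_mem_nhdsLT hab))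
  have hpos : (volume (Set.Ioo c b)) ≠ 0 := by
    rw [Real.volume_Ioo]; simpa using hcb
  obtain ⟨s, hs, hPs⟩ := (frequently_ae_mem_iff.2 hpos).and_eventually hP |>.exists
  exact ⟨s, hPs (hc hs).2, (hc hs).1⟩

/-! ### Conclusion -/

theorem corollaryT (n k q : ℕ) (hk : 1 ≤ k) (hkn : k ≤ n - 1) (hq : 1 ≤ q) (hqn : q ≤ n - 1)
    (a b : ℝ) (hab : a < b) (σ ε : Finset ℕ)
    (hσ : σ ⊆ Finset.range n) (hσk : σ.card = k)
    (hε : ε ⊆ Finset.range n) (hεk : ε.card = n - k)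
    (hNa : ConditionNa n σ ε)
    (hcd : shiftedCount n q σ + shiftedCount n q ε = n - q)
    (hc : 1 ≤ shiftedCount n q σ) (hd : 1 ≤ shiftedCount n q ε)
    (hmax : IsGreatest (σ : Set ℕ) (q + shiftedCount n q σ - 1) ∨
      IsGreatest (ε : Set ℕ) (q + shiftedCount n q ε - 1)) :
    (Even (n - q - shiftedCount n q σ) →
      ¬ ∃ (M : ℝ) (g : ℝ → ℝ → ℝ),
        IsGreenFunction n a b M σ ε g ∧ StronglyNegative n q a b σ ε g) ∧
    (Odd (n - q - shiftedCount n q σ) →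
      ¬ ∃ (M : ℝ) (g : ℝ → ℝ → ℝ),
        IsGreenFunction n a b M σ ε g ∧ StronglyPositive n q a b σ ε g) := by
  have hn : 2 ≤ n := by omega
  have hcard : σ.card + ε.card = n := by omega
  rcases hmax with hmax | hmax
  · have hα := firstFreeIndex_eq_shiftedCount hc (by omega) hmax
    have key : ∀ {M : ℝ} {g : ℝ → ℝ → ℝ}, IsGreenFunction n a b M σ ε g → ∀ᶠ s in 𝓝[>] a,
        0 < (-1 : ℝ) ^ (n - q - shiftedCount n q σ) *
          tDeriv a b (q + shiftedCount n q σ) g a s := fun hg => by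
      rw [Nat.sub_sub]
      exact hg.eventually_tDeriv_left_pos hn hab hσ hε hcard (by omega)
        (lt_of_isGreatest hc hmax)
    constructor
    · rintro he ⟨M, g, hg, -, hneg, -⟩
      obtain ⟨s, h1, h2⟩ := exists_mem_Ioo_of_ae_of_eventually_nhdsGT hab hneg (key hg)
      rw [he.neg_one_pow, one_mul] at h2
      rw [hα, tDeriv_tDeriv] at h1
      exact h1.not_gt h2
    · rintro ho ⟨M, g, hg, -, hpos, -⟩
      obtain ⟨s, h1, h2⟩ := exists_mem_Ioo_of_ae_of_eventually_nhdsGT hab hpos (key hg)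
      rw [ho.neg_one_pow] at h2
      rw [hα, tDeriv_tDeriv] at h1
      linarith
  · have hβ := firstFreeIndex_eq_shiftedCount hd (by omega) hmax
    -- The derivative at `b` is positive for `s` near `b`, so the parity enters only through the
    -- factor `(-1)^(β^q)` of the definition, with `β^q = d_q = n - q - c_q`.
    have hdc : n - q - shiftedCount n q σ = shiftedCount n q ε := by omega
    have key : ∀ {M : ℝ} {g : ℝ → ℝ → ℝ}, IsGreenFunction n a b M σ ε g → ∀ᶠ s in 𝓝[<] b,
        0 < tDeriv a b (q + shiftedCount n q ε) g b s := fun hg =>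
      hg.eventually_tDeriv_right_pos hn hab hσ hε hcard (by omega) (lt_of_isGreatest hd hmax)
    rw [hdc]
    constructor
    · rintro he ⟨M, g, hg, -, -, hneg⟩
      obtain ⟨s, h1, h2⟩ := exists_mem_Ioo_of_ae_of_eventually_nhdsLT hab hneg (key hg)
      rw [hβ, tDeriv_tDeriv, he.neg_one_pow, one_mul] at h1
      exact h1.not_gt h2
    · rintro ho ⟨M, g, hg, -, -, hpos⟩
      obtain ⟨s, h1, h2⟩ := exists_mem_Ioo_of_ae_of_eventually_nhdsLT hab hpos (key hg)
      rw [hβ, tDeriv_tDeriv, ho.neg_one_pow] at h1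
      linarith
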